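/- Let $n\ge 2$, let $\Omega\subseteq\mathbb R^n$ be an open set, and let $\phi:\Omega\to\mathbb R$ belong to $W^{1,n}_{loc}(\Omega)$, i.e. $\phi$ and its first order weak partial derivatives lie in $L^n(K)$ for every compact $K\subset\Omega$. As usual for Sobolev functions, $\phi$ is regarded as defined up to sets of Lebesgue measure zero. Suppose that $e^{\phi}$ is Lipschitz on $\Omega$, i.e. that there is a Lipschitz function $u:\Omega\to\mathbb R$ with $u=e^{\phi}$ almost everywhere on $\Omega$. Then (this Lipschitz representative of) $e^{\phi}$ is nowhere zero: $u(x)\neq 0$ for every $x\in\Omega$. -/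

import Mathlib

open MeasureTheory

/-- `u ∈ L^p_loc(Ω)`: `u` is in `L^p(K)` for every compact `K ⊆ Ω`.
Only the values of `u` on `Ω` matter. -/
def MemLpLoc {n : ℕ} (u : EuclideanSpace ℝ (Fin n) → ℝ) (p : ENNReal)
    (Ω : Set (EuclideanSpace ℝ (Fin n))) : Prop :=
  ∀ K : Set (EuclideanSpace ℝ (Fin n)), IsCompact K → K ⊆ Ω → MemLp u p (volume.restrict K)

/-- `v` is the weak partial derivative `∂u/∂x_i` on the open set `Ω`: both functions are locally
integrable on `Ω`, and `∫_Ω u ∂_i ψ = - ∫_Ω v ψ` for all `ψ ∈ C_c^∞(Ω)`. -/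
def HasWeakPartialDeriv {n : ℕ} (i : Fin n) (u v : EuclideanSpace ℝ (Fin n) → ℝ)
    (Ω : Set (EuclideanSpace ℝ (Fin n))) : Prop :=
  MemLpLoc u 1 Ω ∧ MemLpLoc v 1 Ω ∧
    ∀ ψ : EuclideanSpace ℝ (Fin n) → ℝ,
      ContDiff ℝ (⊤ : ℕ∞) ψ → HasCompactSupport ψ → tsupport ψ ⊆ Ω →
        ∫ x in Ω, u x * fderiv ℝ ψ x (EuclideanSpace.single i 1) = - ∫ x in Ω, v x * ψ x

/-- `u ∈ W^{1,p}_loc(Ω)`: `u` and all its first order weak partial derivatives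
are in `L^p_loc(Ω)`. -/
def MemW1Loc {n : ℕ} (u : EuclideanSpace ℝ (Fin n) → ℝ) (p : ENNReal)
    (Ω : Set (EuclideanSpace ℝ (Fin n))) : Prop :=
  MemLpLoc u p Ω ∧
    ∀ i : Fin n, ∃ v : EuclideanSpace ℝ (Fin n) → ℝ,
      HasWeakPartialDeriv i u v Ω ∧ MemLpLoc v p Ω

/-! If `u x₀ = 0`, the Lipschitz bound gives `φ ≤ log ‖x - x₀‖ + log C` a.e., which
`not_ae_le_log_of_memW1Loc` excludes. Average `φ` over dyadic annuli around `x₀` with weights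
`radialBump` of equal mass `c`. The logarithmic bound makes these averages fall by `c * log 2` per
step, up to a constant. The difference of consecutive weights is the divergence of a compactly
supported field of size `r ^ (1 - n)`, so integration by parts and Hölder with the `L^n` gradient
make consecutive averages differ by `o(1)`. The two rates are incompatible. -/

/-! ### Radial profiles and bumps. -/

/-- A smooth radial profile, as a function of `s = ‖x‖ ^ 2`: it vanishes for `s ≤ r ^ 2` and equals
`s ^ (-n / 2)` for `s ≥ 4 * r ^ 2`. -/
noncomputable def radialProfile (n : ℕ) (r s : ℝ) : ℝ :=
  s ^ (-(n / 2 : ℝ)) * Real.smoothTransition ((s / r ^ 2 - 1) / 3)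

/-- The divergence of `x ↦ radialProfile n r (‖x‖ ^ 2) • x`, as a function of `s = ‖x‖ ^ 2`. -/
noncomputable def radialBump (n : ℕ) (r s : ℝ) : ℝ :=
  n * radialProfile n r s + 2 * s * deriv (radialProfile n r) s

lemma radialProfile_of_le {n : ℕ} {r s : ℝ} (hr : 0 < r) (hs : s ≤ r ^ 2) :
    radialProfile n r s = 0 := by
  have h : s / r ^ 2 ≤ 1 := (div_le_one (by positivity)).2 hs
  rw [radialProfile, Real.smoothTransition.zero_of_nonpos (by linarith), mul_zero]

lemma radialProfile_of_ge {n : ℕ} {r s : ℝ} (hr : 0 < r) (hs : 4 * r ^ 2 ≤ s) :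
    radialProfile n r s = s ^ (-(n / 2 : ℝ)) := by
  have h : 4 ≤ s / r ^ 2 := (le_div_iff₀ (by positivity)).2 hs
  rw [radialProfile, Real.smoothTransition.one_of_one_le (by linarith), mul_one]

/-- The power is singular only at `0`, near which the cutoff vanishes. -/
lemma contDiff_radialProfile (n : ℕ) {r : ℝ} (hr : 0 < r) :
    ContDiff ℝ (⊤ : ℕ∞) (radialProfile n r) := by
  rw [contDiff_iff_contDiffAt]
  intro s
  by_cases hs : s < r ^ 2
  · refine (contDiffAt_const (c := (0 : ℝ))).congr_of_eventuallyEq ?_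
    filter_upwards [Iio_mem_nhds hs] with a ha
    exact radialProfile_of_le hr (le_of_lt ha)
  · have hs0 : 0 < s := lt_of_lt_of_le (by positivity) (not_lt.1 hs)
    refine ContDiffAt.mul (Real.contDiffAt_rpow_const_of_ne hs0.ne') ?_
    exact (Real.smoothTransition.contDiff.comp
      (((contDiff_id.div_const _).sub contDiff_const).div_const _)).contDiffAt

lemma differentiable_radialProfile (n : ℕ) {r : ℝ} (hr : 0 < r) :
    Differentiable ℝ (radialProfile n r) :=
  (contDiff_radialProfile n hr).differentiable (by simp)

lemma continuous_radialBump (n : ℕ) {r : ℝ} (hr : 0 < r) : Continuous (radialBump n r) := by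
  have h := (contDiff_radialProfile n hr).continuous_deriv (by simp)
  have h' := (contDiff_radialProfile n hr).continuous
  unfold radialBump
  fun_prop

/-- Since `x / ‖x‖ ^ n` is divergence-free away from `0`, only the derivative of the cutoff
survives. Sign and annular support of the bump follow. -/
lemma radialBump_eq {n : ℕ} {r s : ℝ} (hs : 0 < s) :
    radialBump n r s = 2 * s * s ^ (-(n / 2 : ℝ)) *
      (deriv Real.smoothTransition ((s / r ^ 2 - 1) / 3) / (3 * r ^ 2)) := by
  have h1 : HasDerivAt (fun s : ℝ => s ^ (-(n / 2 : ℝ))) (-(n / 2 : ℝ) * s ^ (-(n / 2 : ℝ) - 1)) s :=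
    Real.hasDerivAt_rpow_const (Or.inl hs.ne')
  have h2 : HasDerivAt (fun s : ℝ => (s / r ^ 2 - 1) / 3) (1 / r ^ 2 / 3) s :=
    (((hasDerivAt_id s).div_const _).sub_const _).div_const _
  have h3 : HasDerivAt Real.smoothTransition _ ((s / r ^ 2 - 1) / 3) :=
    ((Real.smoothTransition.contDiff (n := 1)).differentiable (by simp) _).hasDerivAt
  have h4 := (h1.mul (h3.comp s h2)).deriv
  have h5 : deriv (radialProfile n r) s = _ := h4
  rw [radialBump, h5, radialProfile, Real.rpow_sub_one hs.ne']
  simp only [Function.comp]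
  field_simp
  ring

lemma radialBump_nonneg {n : ℕ} {r s : ℝ} (hs : 0 ≤ s) : 0 ≤ radialBump n r s := by
  rcases hs.eq_or_lt with rfl | hs
  · simp [radialBump, radialProfile]
    norm_num [Real.smoothTransition.zero_of_nonpos]
  · rw [radialBump_eq hs]
    have := Real.smoothTransition.monotone.deriv_nonneg (x := (s / r ^ 2 - 1) / 3)
    positivity

lemma radialBump_of_lt {n : ℕ} {r s : ℝ} (hr : 0 < r) (hs : s < r ^ 2) : radialBump n r s = 0 := by
  have h : radialProfile n r =ᶠ[nhds s] fun _ => 0 := by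
    filter_upwards [Iio_mem_nhds hs] with a ha
    exact radialProfile_of_le hr (le_of_lt ha)
  rw [radialBump, h.deriv_eq, h.eq_of_nhds]
  simp

lemma radialBump_of_gt {n : ℕ} {r s : ℝ} (hr : 0 < r) (hs : 4 * r ^ 2 < s) :
    radialBump n r s = 0 := by
  have hs0 : 0 < s := lt_of_le_of_lt (by positivity) hs
  have h4 : 4 < s / r ^ 2 := (lt_div_iff₀ (by positivity)).2 hs
  have h : Real.smoothTransition =ᶠ[nhds ((s / r ^ 2 - 1) / 3)] fun _ => 1 := by
    filter_upwards [Ioi_mem_nhds (show 1 < (s / r ^ 2 - 1) / 3 by linarith)] with a ha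
    exact Real.smoothTransition.one_of_one_le (le_of_lt ha)
  rw [radialBump_eq hs0, h.deriv_eq]
  simp

lemma exists_radialBump_ne_zero (n : ℕ) {r : ℝ} (hr : 0 < r) :
    ∃ s, 0 < s ∧ radialBump n r s ≠ 0 := by
  obtain ⟨c, hc, h⟩ := exists_deriv_eq_slope Real.smoothTransition (zero_lt_one)
    Real.smoothTransition.continuous.continuousOn
    ((Real.smoothTransition.contDiff (n := 1)).differentiable (by simp)).differentiableOn
  have hs : 0 < r ^ 2 * (3 * c + 1) := by have := hc.1; positivity
  refine ⟨r ^ 2 * (3 * c + 1), hs, ?_⟩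
  rw [radialBump_eq hs]
  have : (r ^ 2 * (3 * c + 1) / r ^ 2 - 1) / 3 = c := by field_simp; ring
  rw [this, h, Real.smoothTransition.one, Real.smoothTransition.zero]
  have := Real.rpow_pos_of_pos hs (-(n / 2 : ℝ))
  positivity

lemma abs_radialProfile_sub_le {n : ℕ} {r r' a : ℝ} (ha : 0 < a) :
    |radialProfile n r (a ^ 2) - radialProfile n r' (a ^ 2)| ≤ (a ^ n)⁻¹ := by
  have h1 : ((a ^ 2) ^ (-(n / 2 : ℝ)) : ℝ) = (a ^ n)⁻¹ := by
    rw [← Real.rpow_natCast, ← Real.rpow_mul ha.le, ← Real.rpow_natCast, ← Real.rpow_neg ha.le]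
    congr 1
    push_cast
    ring
  rw [radialProfile, radialProfile, ← mul_sub, h1, abs_mul, abs_of_pos (by positivity)]
  refine mul_le_of_le_one_right (by positivity) ?_
  rw [abs_le]
  constructor <;>
  linarith [Real.smoothTransition.nonneg ((a ^ 2 / r ^ 2 - 1) / 3),
    Real.smoothTransition.le_one ((a ^ 2 / r ^ 2 - 1) / 3),
    Real.smoothTransition.nonneg ((a ^ 2 / r' ^ 2 - 1) / 3),
    Real.smoothTransition.le_one ((a ^ 2 / r' ^ 2 - 1) / 3)]

/-! ### Hölder estimates on small balls. -/

lemma integrable_mul_of_memLpLoc {n : ℕ} {Ω K : Set (EuclideanSpace ℝ (Fin n))}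
    {f χ : EuclideanSpace ℝ (Fin n) → ℝ} (hf : MemLpLoc f 1 Ω) (hK : IsCompact K) (hKΩ : K ⊆ Ω)
    (hχ : Continuous χ) (hχK : Function.support χ ⊆ K) : Integrable (fun x => f x * χ x) := by
  have h1 : IntegrableOn f K := memLp_one_iff_integrable.1 (hf K hK hKΩ)
  refine (integrableOn_iff_integrable_of_support_subset ?_).1 (h1.mul_continuousOn hχ.continuousOn hK)
  exact (Function.support_mul_subset_right _ _).trans hχK

/-- Hölder's inequality on small balls: if `f ∈ L^n` near `x₀`, then `∫ |f|` over the ball of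
radius `r` around `x₀` is `o(r ^ (n - 1))`. -/
lemma setIntegral_abs_closedBall_le {n : ℕ} (hn : 1 ≤ n) {x₀ : EuclideanSpace ℝ (Fin n)} {R : ℝ}
    {f : EuclideanSpace ℝ (Fin n) → ℝ}
    (hf : MemLp f n (volume.restrict (Metric.closedBall x₀ R))) {ε : ℝ} (hε : 0 < ε) :
    ∃ δ > 0, ∀ r, 0 < r → r < δ → r ≤ R →
      ∫ x in Metric.closedBall x₀ r, |f x| ≤ ε * r ^ (n - 1) := by
  have hn0 : (n : ℝ) ≠ 0 := by positivity
  set V := volume (Metric.closedBall (0 : EuclideanSpace ℝ (Fin n)) 1) with hV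
  have hVtop : V ≠ ⊤ := measure_closedBall_lt_top.ne
  set W := (V ^ (1 - 1 / (n : ℝ))).toReal with hW
  have hexp : 0 ≤ 1 - 1 / (n : ℝ) := by
    rw [sub_nonneg, div_le_one (by positivity)]
    exact_mod_cast hn
  have hVW : V ^ (1 - 1 / (n : ℝ)) = ENNReal.ofReal W :=
    (ENNReal.ofReal_toReal (ENNReal.rpow_ne_top_of_nonneg hexp hVtop)).symm
  have hW0 : 0 ≤ W := ENNReal.toReal_nonneg
  -- Absolute continuity of the `L^n` norm supplies the little-o; `W + 1` avoids dividing by zero.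
  obtain ⟨δ, hδ, H⟩ := hf.eLpNorm_indicator_le (by exact_mod_cast hn) (by simp)
    (show 0 < ε / (W + 1) by positivity)
  have hvol : ∀ r, 0 < r → volume (Metric.closedBall x₀ r) = ENNReal.ofReal (r ^ n) * V := by
    intro r hr
    rw [Measure.addHaar_closedBall' _ _ hr.le, finrank_euclideanSpace_fin]
  have hlim : Filter.Tendsto (fun r : ℝ => ENNReal.ofReal (r ^ n) * V) (nhds 0) (nhds 0) := by
    have h1 : Filter.Tendsto (fun r : ℝ => ENNReal.ofReal (r ^ n)) (nhds 0) (nhds 0) := by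
      have : Continuous fun r : ℝ => ENNReal.ofReal (r ^ n) :=
        ENNReal.continuous_ofReal.comp (continuous_pow n)
      simpa [show n ≠ 0 by omega] using this.tendsto 0
    simpa using ENNReal.Tendsto.mul_const h1 (Or.inr hVtop)
  obtain ⟨δ', hδ', H'⟩ := Metric.eventually_nhds_iff.1
    (hlim.eventually (gt_mem_nhds (ENNReal.ofReal_pos.2 hδ)))
  refine ⟨δ', hδ', fun r hr hrδ hrR => ?_⟩
  set B := Metric.closedBall x₀ r with hB
  have hBm : MeasurableSet B := Metric.isClosed_closedBall.measurableSet
  have hBR : B ⊆ Metric.closedBall x₀ R := Metric.closedBall_subset_closedBall hrR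
  have hres : (volume.restrict (Metric.closedBall x₀ R)).restrict B = volume.restrict B := by
    rw [Measure.restrict_restrict hBm, Set.inter_eq_left.2 hBR]
  have h1 : eLpNorm f n (volume.restrict B) ≤ ENNReal.ofReal (ε / (W + 1)) := by
    rw [← hres, ← eLpNorm_indicator_eq_eLpNorm_restrict hBm]
    refine H B hBm ((Measure.restrict_apply_le _ _).trans ?_)
    rw [hvol r hr]
    exact (H' (by simpa [abs_of_pos hr] using hrδ)).le
  have hfB : MemLp f n (volume.restrict B) := hf.mono_measure (Measure.restrict_mono hBR le_rfl)
  have h2 := eLpNorm_le_eLpNorm_mul_rpow_measure_univ (p := 1) (q := n)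
    (by exact_mod_cast hn) hfB.1
  have h3 : (ENNReal.ofReal (r ^ n)) ^ (1 - 1 / (n : ℝ)) = ENNReal.ofReal (r ^ (n - 1)) := by
    rw [ENNReal.ofReal_rpow_of_pos (by positivity), ← Real.rpow_natCast, ← Real.rpow_mul hr.le,
      ← Real.rpow_natCast]
    congr 2
    rw [Nat.cast_sub hn]
    field_simp
    simp
  have h4 : eLpNorm f 1 (volume.restrict B) ≤ ENNReal.ofReal (ε * r ^ (n - 1)) := by
    refine h2.trans ?_
    rw [Measure.restrict_apply_univ, hvol r hr, ENNReal.toReal_one, div_one, ENNReal.toReal_natCast,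
      ENNReal.mul_rpow_of_nonneg _ _ hexp, h3, hVW]
    refine (mul_le_mul_left h1 _).trans ?_
    rw [← ENNReal.ofReal_mul (by positivity), ← ENNReal.ofReal_mul (by positivity)]
    refine ENNReal.ofReal_le_ofReal ?_
    have : ε / (W + 1) * (r ^ (n - 1) * W) = (ε * r ^ (n - 1)) * (W / (W + 1)) := by ring
    rw [this]
    exact mul_le_of_le_one_right (by positivity) ((div_le_one (by positivity)).2 (by linarith))
  have h5 : ∫ x in B, |f x| = (eLpNorm f 1 (volume.restrict B)).toReal := by
    rw [eLpNorm_one_eq_lintegral_enorm, ← integral_norm_eq_lintegral_enorm hfB.1]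
    rfl
  rw [h5]
  exact ENNReal.toReal_le_of_le_ofReal (by positivity) h4

/-- Test functions of size `r ^ (1 - n)` supported in the ball of radius `2 * r` have vanishing
pairing with a function that is in `L^n` near the centre. -/
lemma abs_setIntegral_mul_le {n : ℕ} (hn : 1 ≤ n) {x₀ : EuclideanSpace ℝ (Fin n)} {R : ℝ}
    {Ω : Set (EuclideanSpace ℝ (Fin n))} (hΩ : Metric.closedBall x₀ R ⊆ Ω)
    {f : EuclideanSpace ℝ (Fin n) → ℝ}
    (hf : MemLp f n (volume.restrict (Metric.closedBall x₀ R))) {ε : ℝ} (hε : 0 < ε) :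
    ∃ δ > 0, ∀ r, 0 < r → r < δ → 2 * r ≤ R → ∀ ψ : EuclideanSpace ℝ (Fin n) → ℝ,
      (∀ x, |ψ x| ≤ ((r / 2) ^ (n - 1))⁻¹) → Function.support ψ ⊆ Metric.closedBall x₀ (2 * r) →
      |∫ x in Ω, f x * ψ x| ≤ ε := by
  -- The factor `4 ^ (n - 1)` is the ratio of `(2 * r) ^ (n - 1)` to `(r / 2) ^ (n - 1)`.
  obtain ⟨δ, hδ, H⟩ := setIntegral_abs_closedBall_le hn hf (show 0 < ε / 4 ^ (n - 1) by positivity)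
  refine ⟨δ / 2, by positivity, fun r hr hrδ hrR ψ hψ hsupp => ?_⟩
  set B := Metric.closedBall x₀ (2 * r) with hB
  have hBR : B ⊆ Metric.closedBall x₀ R := Metric.closedBall_subset_closedBall hrR
  have hfB : MemLp f n (volume.restrict B) := hf.mono_measure (Measure.restrict_mono hBR le_rfl)
  have hfi : IntegrableOn f B := by
    have : IsFiniteMeasure (volume.restrict B) := ⟨by
      rw [Measure.restrict_apply_univ]; exact measure_closedBall_lt_top⟩
    exact hfB.integrable (by exact_mod_cast hn)
  have h1 : ∫ x in Ω, f x * ψ x = ∫ x in B, f x * ψ x := by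
    rw [setIntegral_eq_integral_of_forall_compl_eq_zero,
      setIntegral_eq_integral_of_forall_compl_eq_zero]
    · intro x hx
      rw [Function.notMem_support.1 fun h => hx (hsupp h), mul_zero]
    · intro x hx
      rw [Function.notMem_support.1 fun h => hx (hΩ (hBR (hsupp h))), mul_zero]
  rw [h1]
  have h2 : ‖∫ x in B, f x * ψ x‖ ≤ ∫ x in B, |f x| * ((r / 2) ^ (n - 1))⁻¹ := by
    refine norm_integral_le_of_norm_le (hfi.abs.mul_const _) (Filter.Eventually.of_forall ?_)
    intro x
    rw [Real.norm_eq_abs, abs_mul]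
    exact mul_le_mul_of_nonneg_left (hψ x) (abs_nonneg _)
  rw [integral_mul_const] at h2
  refine h2.trans ((mul_le_mul_of_nonneg_right
    (H (2 * r) (by positivity) (by linarith) hrR) (by positivity)).trans_eq ?_)
  have : (2 * r) ^ (n - 1) = 4 ^ (n - 1) * (r / 2) ^ (n - 1) := by
    rw [← mul_pow]; congr 1; ring
  rw [this]
  field_simp

/-! ### The radial field and its divergence. -/

/-- The `i`-th component of a compactly supported smooth radial vector field whose divergence is the
difference of the bumps at scales `r / 2` and `r`. -/
noncomputable def radialField {n : ℕ} (x₀ : EuclideanSpace ℝ (Fin n)) (r : ℝ) (i : Fin n)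
    (x : EuclideanSpace ℝ (Fin n)) : ℝ :=
  (x i - x₀ i) * (radialProfile n (r / 2) (‖x - x₀‖ ^ 2) - radialProfile n r (‖x - x₀‖ ^ 2))

section
variable {n : ℕ} (x₀ : EuclideanSpace ℝ (Fin n)) {r : ℝ}

lemma contDiff_radialField (hr : 0 < r) (i : Fin n) :
    ContDiff ℝ (⊤ : ℕ∞) (radialField x₀ r i) := by
  have hs : ContDiff ℝ (⊤ : ℕ∞) fun x : EuclideanSpace ℝ (Fin n) => ‖x - x₀‖ ^ 2 :=
    (contDiff_id.sub contDiff_const).norm_sq ℝ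
  have hx : ContDiff ℝ (⊤ : ℕ∞) fun x : EuclideanSpace ℝ (Fin n) => x i :=
    (EuclideanSpace.proj (𝕜 := ℝ) i).contDiff
  exact (hx.sub contDiff_const).mul
    (((contDiff_radialProfile n (half_pos hr)).comp hs).sub ((contDiff_radialProfile n hr).comp hs))

lemma fderiv_radialField (hr : 0 < r) (i : Fin n) (x : EuclideanSpace ℝ (Fin n)) :
    fderiv ℝ (radialField x₀ r i) x (EuclideanSpace.single i 1) =
      (radialProfile n (r / 2) (‖x - x₀‖ ^ 2) - radialProfile n r (‖x - x₀‖ ^ 2)) +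
      (x i - x₀ i) ^ 2 * (2 * (deriv (radialProfile n (r / 2)) (‖x - x₀‖ ^ 2) -
        deriv (radialProfile n r) (‖x - x₀‖ ^ 2))) := by
  have hs : HasFDerivAt (fun x => ‖x - x₀‖ ^ 2) _ x := ((hasFDerivAt_id x).sub_const x₀).norm_sq
  have hx : HasFDerivAt (fun x : EuclideanSpace ℝ (Fin n) => x i - x₀ i)
      (EuclideanSpace.proj (𝕜 := ℝ) i) x :=
    (EuclideanSpace.proj (𝕜 := ℝ) i).hasFDerivAt.sub_const _
  have hp := fun {ρ : ℝ} (hρ : 0 < ρ) => HasDerivAt.comp_hasFDerivAt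
    (f := fun x => ‖x - x₀‖ ^ 2) x (differentiable_radialProfile n hρ (‖x - x₀‖ ^ 2)).hasDerivAt hs
  have h : HasFDerivAt (radialField x₀ r i) _ x := hx.mul ((hp (half_pos hr)).sub (hp hr))
  rw [h.fderiv]
  simp [EuclideanSpace.inner_single_right]
  ring

lemma sum_fderiv_radialField (hr : 0 < r) (x : EuclideanSpace ℝ (Fin n)) :
    ∑ i, fderiv ℝ (radialField x₀ r i) x (EuclideanSpace.single i 1) =
      radialBump n (r / 2) (‖x - x₀‖ ^ 2) - radialBump n r (‖x - x₀‖ ^ 2) := by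
  simp_rw [fderiv_radialField x₀ hr]
  have h : ∑ i, (x i - x₀ i) ^ 2 = ‖x - x₀‖ ^ 2 := by
    simp [EuclideanSpace.real_norm_sq_eq]
  rw [Finset.sum_add_distrib, ← Finset.sum_mul, h]
  simp [radialBump]
  ring

lemma support_radialField_subset (hr : 0 < r) (i : Fin n) :
    Function.support (radialField x₀ r i) ⊆ Metric.closedBall x₀ (2 * r) := by
  intro x hx
  by_contra hx'
  rw [Metric.mem_closedBall, not_le, dist_eq_norm] at hx'
  refine hx ?_
  have h : 4 * r ^ 2 ≤ ‖x - x₀‖ ^ 2 := by nlinarith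
  rw [radialField, radialProfile_of_ge hr h, radialProfile_of_ge (half_pos hr) (by nlinarith),
    sub_self, mul_zero]

lemma tsupport_radialField_subset (hr : 0 < r) (i : Fin n) :
    tsupport (radialField x₀ r i) ⊆ Metric.closedBall x₀ (2 * r) :=
  closure_minimal (support_radialField_subset x₀ hr i) Metric.isClosed_closedBall

lemma hasCompactSupport_radialField (hr : 0 < r) (i : Fin n) :
    HasCompactSupport (radialField x₀ r i) :=
  (isCompact_closedBall x₀ (2 * r)).of_isClosed_subset (isClosed_tsupport _)
    (tsupport_radialField_subset x₀ hr i)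

lemma continuous_fderiv_radialField (hr : 0 < r) (i : Fin n) :
    Continuous fun x => fderiv ℝ (radialField x₀ r i) x (EuclideanSpace.single i 1) :=
  ((contDiff_radialField x₀ hr i).continuous_fderiv (by simp)).clm_apply continuous_const

lemma support_fderiv_radialField_subset (hr : 0 < r) (i : Fin n) :
    (Function.support fun x => fderiv ℝ (radialField x₀ r i) x (EuclideanSpace.single i 1)) ⊆
      Metric.closedBall x₀ (2 * r) := by
  intro x hx
  refine tsupport_radialField_subset x₀ hr i (support_fderiv_subset ℝ ?_)
  intro h
  exact hx (by simp [h])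

/-- Both profiles vanish within radius `r / 2`; outside it, the field is at most `‖x - x₀‖ * ‖x -
x₀‖ ^ (-n)`. -/
lemma abs_radialField_le (hn : 1 ≤ n) (hr : 0 < r) (i : Fin n) (x : EuclideanSpace ℝ (Fin n)) :
    |radialField x₀ r i x| ≤ ((r / 2) ^ (n - 1))⁻¹ := by
  rcases le_or_gt (‖x - x₀‖) (r / 2) with h | h
  · have h0 := norm_nonneg (x - x₀)
    rw [radialField, radialProfile_of_le hr (by nlinarith),
      radialProfile_of_le (half_pos hr) (by nlinarith), sub_self, mul_zero, abs_zero]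
    positivity
  · have h0 : 0 < ‖x - x₀‖ := by linarith
    have hi : |x i - x₀ i| ≤ ‖x - x₀‖ := by
      simpa using PiLp.norm_apply_le (x - x₀) i
    rw [radialField, abs_mul]
    calc _ ≤ ‖x - x₀‖ * (‖x - x₀‖ ^ n)⁻¹ :=
          mul_le_mul hi (abs_radialProfile_sub_le h0) (abs_nonneg _) h0.le
      _ = (‖x - x₀‖ ^ (n - 1))⁻¹ := by
          obtain ⟨m, rfl⟩ := Nat.exists_eq_add_of_le' hn
          rw [pow_succ, Nat.add_sub_cancel]
          field_simp
      _ ≤ _ := by gcongr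

lemma continuous_radialBump_norm_sq (hr : 0 < r) :
    Continuous fun x : EuclideanSpace ℝ (Fin n) => radialBump n r (‖x - x₀‖ ^ 2) :=
  (continuous_radialBump n hr).comp (by fun_prop)

lemma norm_sub_le_of_radialBump_ne_zero (hr : 0 < r) {x : EuclideanSpace ℝ (Fin n)}
    (hx : radialBump n r (‖x - x₀‖ ^ 2) ≠ 0) : r ≤ ‖x - x₀‖ ∧ ‖x - x₀‖ ≤ 2 * r := by
  constructor
  · by_contra! h
    exact hx (radialBump_of_lt hr (by nlinarith [norm_nonneg (x - x₀)]))
  · by_contra! h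
    exact hx (radialBump_of_gt hr (by nlinarith [norm_nonneg (x - x₀)]))

lemma support_radialBump_subset (hr : 0 < r) :
    (Function.support fun x : EuclideanSpace ℝ (Fin n) => radialBump n r (‖x - x₀‖ ^ 2)) ⊆
      Metric.closedBall x₀ (2 * r) := by
  intro x hx
  rw [Metric.mem_closedBall, dist_eq_norm]
  exact (norm_sub_le_of_radialBump_ne_zero x₀ hr hx).2

lemma hasCompactSupport_radialBump (hr : 0 < r) :
    HasCompactSupport fun x : EuclideanSpace ℝ (Fin n) => radialBump n r (‖x - x₀‖ ^ 2) :=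
  HasCompactSupport.intro (isCompact_closedBall x₀ (2 * r)) fun _ hx =>
    Function.notMem_support.1 fun h => hx (support_radialBump_subset x₀ hr h)

lemma integral_radialBump_pos (hn : 1 ≤ n) (hr : 0 < r) :
    0 < ∫ x : EuclideanSpace ℝ (Fin n), radialBump n r (‖x - x₀‖ ^ 2) := by
  obtain ⟨s, hs, hne⟩ := exists_radialBump_ne_zero n hr
  refine (continuous_radialBump_norm_sq x₀ hr).integral_pos_of_hasCompactSupport_nonneg_nonzero
    (x := x₀ + EuclideanSpace.single ⟨0, hn⟩ √s) (hasCompactSupport_radialBump x₀ hr)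
    (fun _ => radialBump_nonneg (by positivity)) ?_
  simpa [Real.sq_sqrt hs.le] using hne

/-- The difference of the bumps is the divergence of a compactly supported field, so it integrates
to zero. -/
lemma integral_radialBump_half (hr : 0 < r) :
    ∫ x : EuclideanSpace ℝ (Fin n), radialBump n (r / 2) (‖x - x₀‖ ^ 2) =
      ∫ x : EuclideanSpace ℝ (Fin n), radialBump n r (‖x - x₀‖ ^ 2) := by
  have hint : ∀ i : Fin n, Integrable fun x =>
      fderiv ℝ (radialField x₀ r i) x (EuclideanSpace.single i 1) := fun i =>
    (continuous_fderiv_radialField x₀ hr i).integrable_of_hasCompactSupport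
      (HasCompactSupport.intro (isCompact_closedBall x₀ (2 * r)) fun x hx =>
        Function.notMem_support.1 fun h => hx (support_fderiv_radialField_subset x₀ hr i h))
  have hfield : ∀ i : Fin n, Integrable (radialField x₀ r i) := fun i =>
    (contDiff_radialField x₀ hr i).continuous.integrable_of_hasCompactSupport
      (hasCompactSupport_radialField x₀ hr i)
  have hzero : ∀ i : Fin n,
      ∫ x, fderiv ℝ (radialField x₀ r i) x (EuclideanSpace.single i 1) = 0 := by
    intro i
    have h := integral_mul_fderiv_eq_neg_fderiv_mul_of_integrable (μ := volume)
      (f := fun _ : EuclideanSpace ℝ (Fin n) => (1 : ℝ)) (g := radialField x₀ r i)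
      (v := EuclideanSpace.single i 1) (by simp) (by simpa using hint i)
      (by simpa using hfield i)
      (fun x _ => differentiableAt_const _)
      (fun x _ => (contDiff_radialField x₀ hr i).differentiable (by simp) x)
    simpa using h
  rw [← sub_eq_zero, ← integral_sub]
  · simp_rw [← sum_fderiv_radialField x₀ hr]
    rw [integral_finsetSum _ fun i _ => hint i]
    simp [hzero]
  · exact (continuous_radialBump_norm_sq x₀ (half_pos hr)).integrable_of_hasCompactSupport
      (hasCompactSupport_radialBump x₀ (half_pos hr))
  · exact (continuous_radialBump_norm_sq x₀ hr).integrable_of_hasCompactSupport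
      (hasCompactSupport_radialBump x₀ hr)

end

/-! ### Dyadic averages and the contradiction. -/

/-- The weighted averages of a `W^{1,n}` function over dyadic annuli around a point change by `o(1)`
from one annulus to the next. -/
lemma abs_integral_mul_radialBump_half_sub_le {n : ℕ} (hn : 1 ≤ n)
    {Ω : Set (EuclideanSpace ℝ (Fin n))} {φ : EuclideanSpace ℝ (Fin n) → ℝ}
    (hφ : MemW1Loc φ (n : ENNReal) Ω) {x₀ : EuclideanSpace ℝ (Fin n)} {R : ℝ} (hR : 0 < R)
    (hΩ : Metric.closedBall x₀ R ⊆ Ω) {ε : ℝ} (hε : 0 < ε) :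
    ∃ δ > 0, ∀ r, 0 < r → r < δ →
      |∫ x in Ω, φ x * radialBump n (r / 2) (‖x - x₀‖ ^ 2) -
        φ x * radialBump n r (‖x - x₀‖ ^ 2)| ≤ ε := by
  choose v hv hvn using hφ.2
  have hn0 : (0 : ℝ) < n := by exact_mod_cast hn
  have := fun i => abs_setIntegral_mul_le hn hΩ (hvn i _ (isCompact_closedBall x₀ R) hΩ)
    (show 0 < ε / n by positivity)
  choose δ hδ H using this
  have hne : (Finset.univ : Finset (Fin n)).Nonempty := ⟨⟨0, hn⟩, Finset.mem_univ _⟩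
  refine ⟨min (R / 2) (Finset.univ.inf' hne δ),
    lt_min (by positivity) ((Finset.lt_inf'_iff hne).2 fun i _ => hδ i), fun r hr hrδ => ?_⟩
  have hrR : 2 * r ≤ R := by linarith [hrδ.trans_le (min_le_left _ _)]
  have hsub : Metric.closedBall x₀ (2 * r) ⊆ Ω :=
    (Metric.closedBall_subset_closedBall hrR).trans hΩ
  have key : (∫ x in Ω, φ x * radialBump n (r / 2) (‖x - x₀‖ ^ 2) -
      φ x * radialBump n r (‖x - x₀‖ ^ 2)) = ∑ i, -∫ x in Ω, v i x * radialField x₀ r i x := by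
    simp_rw [← mul_sub, ← sum_fderiv_radialField x₀ hr, Finset.mul_sum]
    rw [integral_finsetSum]
    · exact Finset.sum_congr rfl fun i _ => (hv i).2.2 _ (contDiff_radialField x₀ hr i)
        (hasCompactSupport_radialField x₀ hr i) ((tsupport_radialField_subset x₀ hr i).trans hsub)
    · intro i _
      exact (integrable_mul_of_memLpLoc (hv i).1 (isCompact_closedBall x₀ (2 * r)) hsub
        (continuous_fderiv_radialField x₀ hr i)
        (support_fderiv_radialField_subset x₀ hr i)).integrableOn
  rw [key]
  refine (Finset.abs_sum_le_sum_abs _ _).trans ((Finset.sum_le_sum (g := fun _ => ε / n)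
    fun i _ => ?_).trans_eq ?_)
  · rw [abs_neg]
    exact H i r hr ((hrδ.trans_le (min_le_right _ _)).trans_le
      (Finset.inf'_le δ (Finset.mem_univ i))) hrR _ (abs_radialField_le x₀ hn hr i)
      (support_radialField_subset x₀ hr i)
  · simp [mul_div_cancel₀ _ hn0.ne']

/-- A `W^{1,n}` function cannot be bounded above by `log ‖x - x₀‖ + C` near a point `x₀`. -/
lemma not_ae_le_log_of_memW1Loc {n : ℕ} (hn : 1 ≤ n)
    {Ω : Set (EuclideanSpace ℝ (Fin n))} (hΩ : IsOpen Ω) {φ : EuclideanSpace ℝ (Fin n) → ℝ}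
    (hφ : MemW1Loc φ (n : ENNReal) Ω) {x₀ : EuclideanSpace ℝ (Fin n)} (hx₀ : x₀ ∈ Ω) (C : ℝ)
    (h : ∀ᵐ x ∂volume.restrict Ω, φ x ≤ Real.log ‖x - x₀‖ + C) : False := by
  obtain ⟨R, hR, hRΩ⟩ := Metric.nhds_basis_closedBall.mem_iff.1 (hΩ.mem_nhds hx₀)
  have hφ1 : MemLpLoc φ 1 Ω := (hφ.2 ⟨0, hn⟩).choose_spec.1.1
  set c := ∫ x : EuclideanSpace ℝ (Fin n), radialBump n (R / 2) (‖x - x₀‖ ^ 2) with hc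
  have hc0 : 0 < c := integral_radialBump_pos x₀ hn (half_pos hR)
  have hl2 : 0 < Real.log 2 := Real.log_pos one_lt_two
  -- The tolerance is half the drop per step in the logarithmic upper bound.
  obtain ⟨δ, hδ, H⟩ := abs_integral_mul_radialBump_half_sub_le hn hφ hR hRΩ
    (show 0 < c * Real.log 2 / 2 by positivity)
  set ρ : ℕ → ℝ := fun k => R / 2 * (1 / 2) ^ k with hρ
  have hρ0 : ∀ k, 0 < ρ k := fun k => by positivity
  have hρR : ∀ k, 2 * ρ k ≤ R := fun k => by
    have : ((1 : ℝ) / 2) ^ k ≤ 1 := pow_le_one₀ (by norm_num) (by norm_num)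
    simp only [hρ]
    nlinarith
  have hρs : ∀ k, ρ (k + 1) = ρ k / 2 := fun k => by simp only [hρ, pow_succ]; ring
  have hmass : ∀ k, ∫ x : EuclideanSpace ℝ (Fin n), radialBump n (ρ k) (‖x - x₀‖ ^ 2) = c := by
    intro k
    induction k with
    | zero => simp [hρ, hc]
    | succ k ih => rw [hρs, integral_radialBump_half x₀ (hρ0 k), ih]
  have hsub : ∀ k, Metric.closedBall x₀ (2 * ρ k) ⊆ Ω := fun k =>
    (Metric.closedBall_subset_closedBall (hρR k)).trans hRΩ
  have hint : ∀ k, IntegrableOn (fun x => φ x * radialBump n (ρ k) (‖x - x₀‖ ^ 2)) Ω := fun k =>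
    (integrable_mul_of_memLpLoc hφ1 (isCompact_closedBall x₀ (2 * ρ k)) (hsub k)
      (continuous_radialBump_norm_sq x₀ (hρ0 k)) (support_radialBump_subset x₀ (hρ0 k))).integrableOn
  set a : ℕ → ℝ := fun k => ∫ x in Ω, φ x * radialBump n (ρ k) (‖x - x₀‖ ^ 2) with ha
  -- On the support of the `k`-th bump, `‖x - x₀‖ ≤ 2 * ρ k = R / 2 ^ k`.
  have hupper : ∀ k : ℕ, a k ≤ (Real.log R - k * Real.log 2 + C) * c := by
    intro k
    have hlog : Real.log (2 * ρ k) = Real.log R - k * Real.log 2 := by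
      have : 2 * ρ k = R / 2 ^ k := by simp only [hρ, one_div, inv_pow]; ring
      rw [this, Real.log_div hR.ne' (by positivity), Real.log_pow]
    have hcΩ : ∫ x in Ω, radialBump n (ρ k) (‖x - x₀‖ ^ 2) = c := by
      rw [← hmass k]
      exact setIntegral_eq_integral_of_forall_compl_eq_zero fun x hx =>
        Function.notMem_support.1 fun h' => hx (hsub k (support_radialBump_subset x₀ (hρ0 k) h'))
    rw [← hcΩ, ← integral_const_mul]
    refine integral_mono_ae (hint k)
      (((continuous_radialBump_norm_sq x₀ (hρ0 k)).integrable_of_hasCompactSupport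
        (hasCompactSupport_radialBump x₀ (hρ0 k))).integrableOn.const_mul _) ?_
    filter_upwards [h] with x hx
    by_cases hb : radialBump n (ρ k) (‖x - x₀‖ ^ 2) = 0
    · simp [hb]
    · obtain ⟨h1, h2⟩ := norm_sub_le_of_radialBump_ne_zero x₀ (hρ0 k) hb
      refine mul_le_mul_of_nonneg_right (hx.trans ?_) (radialBump_nonneg (by positivity))
      rw [← hlog]
      gcongr
      exact (hρ0 k).trans_le h1
  obtain ⟨N, hN⟩ : ∃ N, ∀ k ≥ N, ρ k < δ := by
    have : Filter.Tendsto ρ Filter.atTop (nhds 0) := by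
      simpa [hρ] using (tendsto_pow_atTop_nhds_zero_of_lt_one (r := (1 / 2 : ℝ)) (by norm_num)
        (by norm_num)).const_mul (R / 2)
    exact Filter.eventually_atTop.1 (this.eventually (gt_mem_nhds hδ))
  have hlower : ∀ j : ℕ, a N - j * (c * Real.log 2 / 2) ≤ a (N + j) := by
    intro j
    induction j with
    | zero => simp
    | succ j ih =>
      have h1 := H _ (hρ0 (N + j)) (hN _ (by omega))
      rw [← hρs, integral_sub (hint (N + j + 1)) (hint (N + j))] at h1
      have h2 : -(c * Real.log 2 / 2) ≤ a (N + j + 1) - a (N + j) := (abs_le.1 h1).1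
      rw [← add_assoc]
      push_cast
      linarith
  -- The gap in slopes is `c * log 2 / 2`; this `j` makes it outweigh the constant terms.
  obtain ⟨j, hj⟩ := exists_nat_gt (((Real.log R + C) * c - a N) / (c * Real.log 2 / 2))
  rw [div_lt_iff₀ (by positivity)] at hj
  have h1 := hlower j
  have h2 := hupper (N + j)
  push_cast at h2
  have h3 : 0 ≤ (N : ℝ) * (Real.log 2 * c) := by positivity
  nlinarith

theorem mainTheorem8 (n : ℕ) (hn : 2 ≤ n)
    (Ω : Set (EuclideanSpace ℝ (Fin n))) (hΩ : IsOpen Ω)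
    (φ : EuclideanSpace ℝ (Fin n) → ℝ) (hφ : MemW1Loc φ (n : ENNReal) Ω)
    (u : EuclideanSpace ℝ (Fin n) → ℝ)
    (hu : u =ᵐ[volume.restrict Ω] fun x => Real.exp (φ x))
    (hLip : ∃ C : NNReal, LipschitzOnWith C u Ω) :
    ∀ x ∈ Ω, u x ≠ 0 := by
  obtain ⟨C, hC⟩ := hLip
  intro x₀ hx₀ h0
  refine not_ae_le_log_of_memW1Loc (by omega) hΩ hφ hx₀ (Real.log C) ?_
  filter_upwards [hu, ae_restrict_mem hΩ.measurableSet] with x hx hxΩ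
  have h1 := hC.dist_le_mul x hxΩ x₀ hx₀
  rw [h0, dist_zero_right, hx, Real.norm_eq_abs, Real.abs_exp, dist_eq_norm] at h1
  -- Positivity of `exp` excludes `C = 0` and `x = x₀`, so the logarithm splits.
  have h2 : 0 < (C : ℝ) * ‖x - x₀‖ := (Real.exp_pos _).trans_le h1
  have h3 := Real.log_le_log (Real.exp_pos _) h1
  rw [Real.log_exp, Real.log_mul (left_ne_zero_of_mul h2.ne') (right_ne_zero_of_mul h2.ne')] at h3
  linarith
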